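/- Let $n,k,d$ be integers with $n\ge 2$, $1\le k\le n-1$, $1\le d\le n-1$, and let $\mathcal M>0$ be a real number (the file size). *Family helper selection (FHS) scheme.* Number the storage nodes $1,\dots,n$. The first $n-d$ nodes form the first complete family, the next $n-d$ nodes the second, and so on, giving $\lfloor n/(n-d)\rfloor$ complete families; the remaining $n \bmod (n-d)$ nodes form the incomplete family. Whenever node $i$ fails, its replacement (newcomer) contacts the fixed helper set $D_i$, where $D_i$ is the set of all nodes outside the family of $i$ if $i$ is in a complete family, and $D_i=\{1,\dots,d\}$ if $i$ is in the incomplete family. *Information flow graphs.* Let $\alpha,\beta\in[0,\infty]$. For each finite sequence of failed nodes (with repetitions allowed) there is a capacitated directed graph $G$ with a source $s$ and, for each of the $n$ initial storage nodes and each newcomer $x$, two vertices $x_{\rm in},x_{\rm out}$ joined by an edge $x_{\rm in}\to x_{\rm out}$ of capacity $\alpha$. The source has an edge of infinite capacity to $x_{\rm in}$ for every initial storage node $x$. The newcomer $x$ replacing a failed node $i$ has an edge of capacity $\beta$ into $x_{\rm in}$ from the output vertex of the storage node currently representing $j$ (the most recent newcomer for $j$, or the initial one if $j$ has not failed before), for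 every $j\in D_i$. For every choice of $k$ of the $n$ nodes there is a data collector $t$ with edges of infinite capacity from the output vertices of the storage nodes representing these $k$ nodes after the last failure. Let $\mathcal G_F$ be the set of all these graphs, $\mathrm{DC}(G)$ the set of data collectors of $G$, and $\mathrm{mincut}_G(s,t)$ the minimum capacity of a directed cut separating $s$ from $t$. Consider the condition $$\min_{G\in\mathcal G_F}\ \min_{t\in \mathrm{DC}(G)}\mathrm{mincut}_G(s,t)\ \ge\ \mathcal M .\tag{$*$}$$ *MSR point.* Let $\alpha_{\rm MSR}$ be the minimum of all $\alpha$ such that $(\alpha,\infty)$ satisfies $(*)$, and let $\beta_{\rm MSR}$ be the minimum of all $\beta$ such that $(\alpha_{\rm MSR},\beta)$ satisfies $(*)$. **Proposition.** The minimum-storage regenerating point $(\alpha_{\rm MSR},\beta_{\rm MSR})$ of the FHS scheme exists (both minima are attained), and $$\alpha_{\rm MSR}=\frac{\mathcal M}{\min(d,k)} .$$ If $d\ge k$, then $\beta_{\rm MSR}=\dfrac{\mathcal M}{k(d-k+1)}$. If $d<k$, then $\beta_{\rm MSR}\le \dfrac{\mathcal M}{d}$. -/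

import Mathlib

open scoped ENNReal

namespace RegeneratingCodes

/-- A stationary helper selection (SHS) scheme on the physical nodes `Fin n`: the newcomer that
replaces a failed physical node `i` always contacts the fixed helper set `D i`. -/
abbrev SHS (n : ℕ) : Type := Fin n → Finset (Fin n)

/-- The family helper selection scheme for `(n, d)`.  With nodes numbered from `0`, the family of
node `i` is `i / (n - d)`; the families `0, …, n / (n - d) - 1` are complete (they have `n - d`
members) and the remaining `n % (n - d)` nodes form the incomplete family.  A member of a complete
family is helped by all nodes outside its family, a member of the incomplete family by the first
`d` nodes. -/
def fhs (n d : ℕ) : SHS n := fun i =>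
  if (i : ℕ) / (n - d) < n / (n - d) then
    Finset.univ.filter fun j : Fin n => (j : ℕ) / (n - d) ≠ (i : ℕ) / (n - d)
  else
    Finset.univ.filter fun j : Fin n => (j : ℕ) < d

/-- Storage nodes of an information flow graph after `T` failures: the `n` initial nodes
`Sum.inl i`, and for each failure time `τ` the newcomer `Sum.inr τ` created then. -/
abbrev StorageNode (n T : ℕ) : Type := Fin n ⊕ Fin T

/-- The physical node that a storage node implements, where `F τ` is the physical node that fails
at time `τ`. -/
def label {n T : ℕ} (F : Fin T → Fin n) : StorageNode n T → Fin n
  | Sum.inl i => i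
  | Sum.inr τ => F τ

/-- `Active F t x`: the storage node `x` exists and has not failed when exactly the failures at
times `0, …, t - 1` have taken place. -/
def Active {n T : ℕ} (F : Fin T → Fin n) (t : ℕ) : StorageNode n T → Prop
  | Sum.inl i => ∀ σ : Fin T, (σ : ℕ) < t → F σ ≠ i
  | Sum.inr ρ => (ρ : ℕ) < t ∧ ∀ σ : Fin T, ρ < σ → (σ : ℕ) < t → F σ ≠ F ρ

/-- Vertices of an information flow graph: the source, the input and the output vertex of every
storage node, and one data collector for each choice of `k` of the `n` (currently active)
physical nodes. -/
inductive Vertex (n k T : ℕ) : Type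
  | source : Vertex n k T
  | inp (x : StorageNode n T) : Vertex n k T
  | out (x : StorageNode n T) : Vertex n k T
  | dc (S : {S : Finset (Fin n) // S.card = k}) : Vertex n k T
  deriving DecidableEq, Fintype

open Classical in
/-- Edge capacities of the information flow graph of the scheme `D` with failure pattern `F`, with
storage `α` per node and traffic `β` per helper (capacity `0` means that there is no edge):
* the source feeds every initial storage node with infinite capacity;
* the input and the output of a storage node are joined with capacity `α`;
* the newcomer at time `τ` receives `β` from each of its helpers, which are the storage nodes that
  are active just before its creation and implement a physical node in `D (F τ)`;
* a data collector reads with infinite capacity from the `k` finally active storage nodes that it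
  has chosen. -/
noncomputable def capacity {n : ℕ} (k : ℕ) {T : ℕ} (D : SHS n) (F : Fin T → Fin n)
    (α β : ℝ≥0∞) : Vertex n k T → Vertex n k T → ℝ≥0∞
  | .source, .inp (Sum.inl _) => ⊤
  | .inp x, .out y => if x = y then α else 0
  | .out x, .inp (Sum.inr τ) => if Active F τ x ∧ label F x ∈ D (F τ) then β else 0
  | .out x, .dc S => if Active F T x ∧ label F x ∈ S.1 then ⊤ else 0
  | _, _ => 0

/-- The minimum value of a directed cut separating `s` from `t` in a capacitated digraph. -/
noncomputable def minCut {V : Type*} [Fintype V] [DecidableEq V] (c : V → V → ℝ≥0∞)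
    (s t : V) : ℝ≥0∞ :=
  ⨅ (U : Finset V) (_ : s ∈ U) (_ : t ∉ U), ∑ u ∈ U, ∑ v ∈ Uᶜ, c u v

/-- The minimum of `mincut_G(s, t)` over all information flow graphs `G` of the scheme `D` (that
is, over all finite failure patterns) and over all data collectors `t` of `G`. -/
noncomputable def minMinCut {n : ℕ} (k : ℕ) (D : SHS n) (α β : ℝ≥0∞) : ℝ≥0∞ :=
  ⨅ (T : ℕ) (F : Fin T → Fin n) (S : {S : Finset (Fin n) // S.card = k}),
    minCut (capacity k D F α β) Vertex.source (Vertex.dc S)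

/-- The min-cut condition for protecting a file of size `M`. -/
def Reliable {n : ℕ} (k : ℕ) (D : SHS n) (M : ℝ) (α β : ℝ≥0∞) : Prop :=
  ENNReal.ofReal M ≤ minMinCut k D α β

/-- `(αMSR, βMSR)` is the minimum-storage regenerating point of the scheme `D`: `αMSR` is the
minimum storage when `β = ∞`, and `βMSR` is the minimum `β` when `α = αMSR`; both minima are
attained. -/
def IsMSRPoint {n : ℕ} (k : ℕ) (D : SHS n) (M : ℝ) (αMSR βMSR : ℝ≥0∞) : Prop :=
  IsLeast {α : ℝ≥0∞ | Reliable k D M α ⊤} αMSR ∧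
    IsLeast {β : ℝ≥0∞ | Reliable k D M αMSR β} βMSR

end RegeneratingCodes

namespace RegeneratingCodes

open Finset

/-! Put `m = min d k`. Lower bound, for every scheme with at least `d` helpers per node: among the
storage nodes whose outputs lie on the sink side of a cut, take the `m` oldest. A newcomer among
them has at most `m - 1` of its helpers among the others, so it costs `α` or at least `(d - m + 1)
β`. Hence `α = M / m` suffices once `(d - m + 1) β ≥ α`. Upper bounds come from explicit cuts of
value `k α`, `d α` (the only one using the family structure) and, for `k ≤ d`, `(k - 1) α + (d - k +
1) β`. The first two force `α ≥ M / m`, the third forces the value of `β` when `k ≤ d`. The minimal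
`β` exists because reliability is a closed condition on the compact space `[0, ∞]`. -/

/-- A finite set contains lower segments, with respect to any rank function, of every size. -/
theorem exists_lower_subset_card_eq {X : Type*} (r : X → ℕ) (W : Finset X) (m : ℕ)
    (hm : m ≤ #W) :
    ∃ A ⊆ W, #A = m ∧ ∀ x ∈ A, ∀ y ∈ W, r y < r x → y ∈ A := by
  classical
  induction m with
  | zero => exact ⟨∅, by simp⟩
  | succ m ih =>
    obtain ⟨A, hAW, hA, hlow⟩ := ih (by omega)
    have hne : (W \ A).Nonempty := by
      rw [← card_pos, card_sdiff_of_subset hAW]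
      omega
    obtain ⟨x, hx, hmin⟩ := exists_min_image (W \ A) r hne
    rw [mem_sdiff] at hx
    refine ⟨insert x A, insert_subset hx.1 hAW, by rw [card_insert_of_notMem hx.2, hA], ?_⟩
    intro z hz y hy hyz
    by_contra hcon
    rw [mem_insert, not_or] at hcon
    rcases mem_insert.1 hz with rfl | hz
    · exact absurd (hmin y (mem_sdiff.2 ⟨hy, hcon.2⟩)) (by omega)
    · exact hcon.2 (hlow z hz y hy hyz)

/-! ### Lower bound for all cuts. -/

/-- At every time each physical node is implemented by an active storage node. -/
theorem exists_active {n T : ℕ} (F : Fin T → Fin n) (i : Fin n) (t : ℕ) :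
    ∃ x, Active F t x ∧ label F x = i := by
  by_cases h : (univ.filter fun σ : Fin T => (σ : ℕ) < t ∧ F σ = i).Nonempty
  · obtain ⟨ρ, hρ, hmax⟩ := exists_max_image _ id h
    simp only [mem_filter, mem_univ, true_and, id] at hρ hmax
    refine ⟨Sum.inr ρ, ⟨hρ.1, fun σ h1 h2 h3 => ?_⟩, hρ.2⟩
    exact absurd (hmax σ ⟨h2, h3.trans hρ.2⟩) (not_le.2 h1)
  · refine ⟨Sum.inl i, fun σ hσ hi => h ⟨σ, ?_⟩, rfl⟩
    simp [hσ, hi]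

/-- The order in which storage nodes are created. -/
def creation {n T : ℕ} : StorageNode n T → ℕ
  | Sum.inl i => i
  | Sum.inr τ => n + τ

theorem Active.creation_lt {n T : ℕ} {F : Fin T → Fin n} {τ : Fin T} {x : StorageNode n T}
    (h : Active F τ x) : creation x < creation (Sum.inr τ : StorageNode n T) := by
  rcases x with i | ρ
  · have := i.2
    simp only [creation]
    omega
  · have := h.1
    simp only [creation]
    omega

/-- A cut that separates `m` output vertices, none of them before another separated one, has
value at least `m` times the smaller of the storage and the residual repair traffic. -/
theorem mul_min_le_cut {n k d m T : ℕ} (D : SHS n) (hD : ∀ i, d ≤ #(D i)) (hmk : m ≤ k)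
    (hmd : m ≤ d)    (F : Fin T → Fin n) (α β : ENNReal)
    (S : {S : Finset (Fin n) // S.card = k}) (U : Finset (Vertex n k T))
    (hs : Vertex.source ∈ U) (ht : Vertex.dc S ∉ U) :
    (m : ENNReal) * min α (((d - m + 1 : ℕ) : ENNReal) * β) ≤
      ∑ u ∈ U, ∑ v ∈ Uᶜ, capacity k D F α β u v := by
  classical
  -- If the collector reads from an output on the source side, an infinite edge is cut.
  by_cases hread : ∃ x, Active F T x ∧ label F x ∈ S.1 ∧ Vertex.out x ∈ U
  · obtain ⟨x, hx, hxS, hxU⟩ := hread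
    have : (⊤ : ENNReal) ≤ ∑ u ∈ U, ∑ v ∈ Uᶜ, capacity k D F α β u v :=
      calc (⊤ : ENNReal) = capacity k D F α β (.out x) (.dc S) := by simp [capacity, hx, hxS]
        _ ≤ ∑ v ∈ Uᶜ, capacity k D F α β (.out x) v :=
          single_le_sum_of_canonicallyOrdered (f := capacity k D F α β (.out x))
            (mem_compl.2 ht)
        _ ≤ _ := single_le_sum_of_canonicallyOrdered
          (f := fun u => ∑ v ∈ Uᶜ, capacity k D F α β u v) hxU
    exact le_top.trans this
  push Not at hread
  set W : Finset (StorageNode n T) := univ.filter fun x => Vertex.out x ∉ U with hW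
  have hWcard : m ≤ #W := by
    choose g hg hgl using fun i => exists_active F i T
    calc m ≤ #S.1 := by rw [S.2]; exact hmk
      _ ≤ #W := card_le_card_of_injOn g
          (fun i hi => by
            simp only [hW, coe_filter, mem_univ, true_and, Set.mem_ofPred_eq]
            exact hread _ (hg i) (by rw [hgl]; exact hi))
          (fun i _ j _ hij => by rw [← hgl i, ← hgl j, hij])
  obtain ⟨A, hAW, hA, hlow⟩ := exists_lower_subset_card_eq creation W m hWcard
  -- Each `x ∈ A` is charged the cut edges entering one sink-side vertex of its own; as `g` is
  -- injective, the charges add up.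
  let g : StorageNode n T → Vertex n k T := fun x =>
    if Vertex.inp x ∈ U then .out x else .inp x
  have hginj : Function.Injective g := by
    intro x y hxy
    simp only [g] at hxy
    split_ifs at hxy <;> simpa using hxy
  have hgU : A.image g ⊆ Uᶜ := by
    intro v hv
    obtain ⟨x, hx, rfl⟩ := mem_image.1 hv
    have := (mem_filter.1 (hAW hx)).2
    simp only [g, mem_compl]
    split_ifs with h <;> assumption
  have key : ∀ x ∈ A, min α (((d - m + 1 : ℕ) : ENNReal) * β) ≤
      ∑ u ∈ U, capacity k D F α β u (g x) := by
    intro x hx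
    by_cases hxU : Vertex.inp x ∈ U
    · refine (min_le_left _ _).trans ?_
      refine le_trans ?_ (single_le_sum_of_canonicallyOrdered
        (f := fun u => capacity k D F α β u (g x)) hxU)
      simp [g, hxU, capacity]
    · simp only [g, hxU, if_false]
      rcases x with i | τ
      · refine le_trans ?_ (single_le_sum_of_canonicallyOrdered
          (f := fun u => capacity k D F α β u (Vertex.inp (Sum.inl i))) hs)
        simp [capacity]
      · refine (min_le_right _ _).trans ?_
        choose h hh hhl using fun j => exists_active F j τ
        have hinj : Function.Injective h := fun i j hij => by rw [← hhl i, ← hhl j, hij]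
        let H := (D (F τ)).image h
        have hHcard : d ≤ #H := by
          rw [card_image_of_injective _ hinj]
          exact hD _
        -- The newcomer lies in `A` but is created after all its helpers, hence `m - 1` instead of
        -- `m`.
        have hHA : #(H ∩ A) ≤ m - 1 := by
          rw [← hA, ← card_erase_of_mem hx]
          refine card_le_card fun y hy => ?_
          obtain ⟨hyH, hyA⟩ := mem_inter.1 hy
          obtain ⟨j, -, rfl⟩ := mem_image.1 hyH
          refine mem_erase.2 ⟨fun heq => ?_, hyA⟩
          have := (hh j).creation_lt
          rw [heq] at this
          exact lt_irrefl _ this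
        have hmpos : 0 < m := hA ▸ card_pos.2 ⟨_, hx⟩
        have hcard : d - m + 1 ≤ #(H \ A) := by
          have := card_sdiff_add_card_inter H A
          omega
        -- A helper on the sink side would be older than the newcomer, so the initial segment `A`
        -- would contain it.
        have hsub : (H \ A).image Vertex.out ⊆ U := by
          intro v hv
          obtain ⟨y, hy, rfl⟩ := mem_image.1 hv
          obtain ⟨hyH, hyA⟩ := mem_sdiff.1 hy
          obtain ⟨j, -, rfl⟩ := mem_image.1 hyH
          by_contra hyU
          exact hyA (hlow _ hx _ (mem_filter.2 ⟨mem_univ _, hyU⟩) (hh j).creation_lt)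
        calc ((d - m + 1 : ℕ) : ENNReal) * β ≤ (#(H \ A) : ENNReal) * β := by gcongr
          _ = ∑ y ∈ H \ A, capacity k D F α β (.out y) (.inp (Sum.inr τ)) := by
            rw [← nsmul_eq_mul, ← sum_const]
            refine sum_congr rfl fun y hy => ?_
            obtain ⟨j, hj, rfl⟩ := mem_image.1 (mem_sdiff.1 hy).1
            simp [capacity, hh, hhl, hj]
          _ = ∑ u ∈ (H \ A).image Vertex.out,
              capacity k D F α β u (.inp (Sum.inr τ)) := by
            rw [sum_image fun x _ y _ hxy => by simpa using hxy]
          _ ≤ _ := sum_le_sum_of_subset hsub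
  calc (m : ENNReal) * min α (((d - m + 1 : ℕ) : ENNReal) * β)
      = ∑ x ∈ A, min α (((d - m + 1 : ℕ) : ENNReal) * β) := by
        rw [sum_const, hA, nsmul_eq_mul]
    _ ≤ ∑ x ∈ A, ∑ u ∈ U, capacity k D F α β u (g x) := sum_le_sum key
    _ = ∑ v ∈ A.image g, ∑ u ∈ U, capacity k D F α β u v := by
        rw [sum_image hginj.injOn]
    _ ≤ ∑ v ∈ Uᶜ, ∑ u ∈ U, capacity k D F α β u v :=
        sum_le_sum_of_subset hgU
    _ = _ := sum_comm

theorem mul_min_le_minMinCut {n k d m : ℕ} (D : SHS n) (hD : ∀ i, d ≤ #(D i)) (hmk : m ≤ k)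
    (hmd : m ≤ d) (α β : ENNReal) :
    (m : ENNReal) * min α (((d - m + 1 : ℕ) : ENNReal) * β) ≤ minMinCut k D α β :=
  le_iInf fun _ => le_iInf fun F => le_iInf fun S => le_iInf fun U => le_iInf fun hs =>
    le_iInf fun ht => mul_min_le_cut D hD hmk hmd F α β S U hs ht

/-! ### Upper bounds from explicit cuts. -/

/-- The cut that separates the storage nodes of `A` between input and output, and the newcomers
of `B` before their inputs. -/
theorem minMinCut_le {n k T : ℕ} (D : SHS n) (F : Fin T → Fin n) (α β : ENNReal)
    (S : {S : Finset (Fin n) // S.card = k}) (A : Finset (StorageNode n T)) (B : Finset (Fin T))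
    (P : StorageNode n T → Fin T → Prop) [∀ x τ, Decidable (P x τ)]
    (hS : ∀ x, Active F T x → label F x ∈ S.1 → x ∈ A ∨ ∃ τ ∈ B, x = Sum.inr τ)
    (hP : ∀ τ ∈ B, ∀ x, Active F τ x → label F x ∈ D (F τ) → x ∉ A →
      (∀ σ ∈ B, x ≠ Sum.inr σ) → P x τ) :
    minMinCut k D α β ≤ (#A : ENNReal) * α + ∑ τ ∈ B, ∑ x, if P x τ then β else 0 := by
  classical
  let VB : Finset (Vertex n k T) := B.image fun τ => .inp (Sum.inr τ)
  let VA : Finset (Vertex n k T) := A.image .out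
  let V : Finset (Vertex n k T) :=
    insert (.dc S) ((VA ∪ VB) ∪ B.image fun τ => .out (Sum.inr τ))
  let f : Vertex n k T → ENNReal := fun v => ∑ u ∈ Vᶜ, capacity k D F α β u v
  have hout : ∀ x, (.out x : Vertex n k T) ∉ V ↔ x ∉ A ∧ ∀ τ ∈ B, x ≠ Sum.inr τ := by
    intro x
    simp [V, VA, VB, eq_comm]
  have hinp : ∀ x, (.inp x : Vertex n k T) ∈ V ↔ ∃ τ ∈ B, x = Sum.inr τ := by
    intro x
    simp [V, VA, VB, eq_comm]
  have hdc : f (.dc S) = 0 := by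
    refine sum_eq_zero fun u hu => ?_
    rw [mem_compl] at hu
    rcases u with _ | x | x | S'
    · rfl
    · rfl
    · rw [hout] at hu
      simp only [capacity, ite_eq_right_iff]
      rintro ⟨hx, hxS⟩
      rcases hS x hx hxS with h | ⟨τ, hτ, h⟩
      · exact absurd h hu.1
      · exact absurd h (hu.2 τ hτ)
    · rfl
  have hfB : ∀ τ ∈ B, f (.out (Sum.inr τ)) = 0 := by
    intro τ hτ
    refine sum_eq_zero fun u hu => ?_
    rw [mem_compl] at hu
    rcases u with _ | x | x | S'
    · rfl
    · simp only [capacity, ite_eq_right_iff]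
      rintro rfl
      exact absurd ((hinp _).2 ⟨τ, hτ, rfl⟩) hu
    · rfl
    · rfl
  have hfA : ∀ x, f (.out x) ≤ α := by
    intro x
    calc f (.out x) ≤ ∑ u, capacity k D F α β u (.out x) :=
          sum_le_sum_of_subset (subset_univ _)
      _ = capacity k D F α β (.inp x) (.out x) := by
          refine sum_eq_single _ (fun u _ hu => ?_) (by simp)
          rcases u with _ | y | y | S'
          · rfl
          · have : y ≠ x := fun h => hu (by rw [h])
            simp [capacity, this]
          · rfl
          · rfl
      _ = α := by simp [capacity]
  -- `P` only has to contain the helper edges that cross the cut.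
  have hfinp : ∀ τ ∈ B, f (.inp (Sum.inr τ)) ≤ ∑ x, if P x τ then β else 0 := by
    intro τ hτ
    calc f (.inp (Sum.inr τ))
        = ∑ u ∈ Vᶜ ∩ univ.image Vertex.out, capacity k D F α β u (.inp (Sum.inr τ)) := by
          refine (sum_subset inter_subset_left fun u hu hu' => ?_).symm
          rcases u with _ | y | y | S'
          · rfl
          · rfl
          · exact absurd (mem_inter.2 ⟨hu, by simp⟩) hu'
          · rfl
      _ ≤ ∑ u ∈ univ.image (Vertex.out : StorageNode n T → Vertex n k T),
          if u ∈ V then 0 else capacity k D F α β u (.inp (Sum.inr τ)) := by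
          rw [inter_comm, ← filter_mem_eq_inter, sum_filter]
          refine sum_le_sum fun u _ => ?_
          by_cases h : u ∈ V <;> simp [h]
      _ = ∑ x, if (.out x : Vertex n k T) ∈ V then 0 else
          capacity k D F α β (.out x) (.inp (Sum.inr τ)) := by
          rw [sum_image fun x _ y _ hxy => by simpa using hxy]
      _ ≤ _ := by
          refine sum_le_sum fun x _ => ?_
          by_cases hx : (.out x : Vertex n k T) ∈ V
          · simp [hx]
          · have hx' := (hout x).1 hx
            by_cases hact : Active F τ x ∧ label F x ∈ D (F τ)
            · simp [hx, capacity, hact, hP τ hτ x hact.1 hact.2 hx'.1 hx'.2]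
            · simp [hx, capacity, hact]
  have hcut : minMinCut k D α β ≤ ∑ v ∈ V, f v := by
    have hsource : Vertex.source ∈ Vᶜ := by simp [V, VA, VB]
    have hsink : Vertex.dc S ∉ Vᶜ := by simp [V]
    have hval : ∑ u ∈ Vᶜ, ∑ v ∈ Vᶜᶜ, capacity k D F α β u v = ∑ v ∈ V, f v := by
      rw [compl_compl, sum_comm]
    refine (iInf_le_of_le T <| iInf_le_of_le F <| iInf_le _ S).trans ?_
    rw [← hval]
    exact iInf_le_of_le Vᶜ <| iInf_le_of_le hsource <| iInf_le _ hsink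
  have hunion : ∀ X Y : Finset (Vertex n k T), ∑ v ∈ X ∪ Y, f v ≤ ∑ v ∈ X, f v + ∑ v ∈ Y, f v :=
    fun X Y => by rw [← sum_union_inter]; exact le_self_add
  calc minMinCut k D α β ≤ ∑ v ∈ V, f v := hcut
    _ ≤ ∑ v ∈ VA, f v + ∑ v ∈ VB, f v := by
        rw [sum_insert (by simp [VA, VB]), hdc, zero_add]
        refine (hunion _ _).trans ?_
        rw [sum_eq_zero (s := B.image _) (by simpa using hfB), add_zero]
        exact hunion _ _
    _ ≤ _ := by
        refine add_le_add ?_ ?_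
        · rw [sum_image fun x _ y _ hxy => by simpa using hxy, ← nsmul_eq_mul, ← sum_const]
          exact sum_le_sum fun x _ => hfA x
        · rw [sum_image fun x _ y _ hxy => by simpa using hxy]
          exact sum_le_sum hfinp

/-- With no failures, it suffices to cut the storage edges of the `k` initial nodes being read. -/
theorem minMinCut_le_mul {n k : ℕ} (hkn : k ≤ n) (D : SHS n) (α β : ENNReal) :
    minMinCut k D α β ≤ k * α := by
  obtain ⟨S, -, hS⟩ := exists_subset_card_eq (s := (univ : Finset (Fin n))) (n := k)
    (by simpa using hkn)
  refine (minMinCut_le D (Fin.elim0 : Fin 0 → Fin n) α β ⟨S, hS⟩ (S.image Sum.inl) ∅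
    (fun _ _ => False) ?_ (by simp)).trans ?_
  · rintro (i | τ) _ hi
    · exact Or.inl (mem_image_of_mem _ hi)
    · exact τ.elim0
  · rw [sum_empty, add_zero]
    gcongr
    exact card_image_le.trans hS.le

/-- A newcomer read together with `k - 1` of its helpers. -/
theorem minMinCut_le_of_helpers {n k d : ℕ} (hk : 1 ≤ k) (hkd : k ≤ d) (D : SHS n) (i : Fin n)
    (hi : i ∉ D i) (hD : #(D i) = d) (α β : ENNReal) :
    minMinCut k D α β ≤ ((k - 1 : ℕ) : ENNReal) * α + ((d - k + 1 : ℕ) : ENNReal) * β := by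
  classical
  obtain ⟨R, hRD, hR⟩ := exists_subset_card_eq (s := D i) (n := k - 1) (by omega)
  have hcard : #(insert i R) = k := by
    rw [card_insert_of_notMem fun h => hi (hRD h), hR]
    omega
  refine (minMinCut_le D (fun _ : Fin 1 => i) α β ⟨insert i R, hcard⟩ (R.image Sum.inl) univ
    (fun x _ => ∃ j ∈ D i \ R, x = Sum.inl j) ?_ ?_).trans ?_
  · rintro (j | τ) hx hj
    · rcases mem_insert.1 hj with hji | hj
      · exact absurd hji.symm (hx 0 (by simp))
      · exact Or.inl (mem_image_of_mem _ hj)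
    · exact Or.inr ⟨τ, mem_univ _, rfl⟩
  · rintro τ - (j | σ) _ hj hjR hσ
    · exact ⟨j, mem_sdiff.2 ⟨hj, fun h => hjR (mem_image_of_mem _ h)⟩, rfl⟩
    · exact absurd rfl (hσ σ (mem_univ _))
  · have h2 : #(D i \ R) = d - k + 1 := by
      rw [card_sdiff_of_subset hRD]
      omega
    refine add_le_add (by gcongr; exact card_image_le.trans hR.le) ?_
    rw [univ_unique, sum_singleton, ← sum_filter, sum_const, nsmul_eq_mul, ← h2]
    gcongr
    calc _ ≤ #((D i \ R).image (Sum.inl : Fin n → StorageNode n 1)) := by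
          refine card_le_card fun x hx => ?_
          obtain ⟨j, hj, rfl⟩ := (mem_filter.1 hx).2
          exact mem_image_of_mem _ hj
      _ ≤ _ := card_image_le

/-! ### The family structure. -/

theorem card_fhs {n d : ℕ} (hdn : d < n) (i : Fin n) : #(fhs n d i) = d := by
  have hpos : 0 < n - d := by omega
  rw [fhs]
  split_ifs with h
  · have hcompl : #(univ.filter fun j : Fin n => (j : ℕ) / (n - d) = (i : ℕ) / (n - d)) =
        n - d := by
      -- Completeness of the family means that its block of `n - d` consecutive numbers fits below
      -- `n`.
      have hlt : ((i : ℕ) / (n - d) + 1) * (n - d) ≤ n :=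
        (Nat.mul_le_mul_right _ h).trans (Nat.div_mul_le_self _ _)
      calc _ = #((univ.filter fun j : Fin n =>
            (j : ℕ) / (n - d) = (i : ℕ) / (n - d)).map Fin.valEmbedding) := (card_map _).symm
        _ = #(Ico ((i : ℕ) / (n - d) * (n - d)) (((i : ℕ) / (n - d) + 1) * (n - d))) := by
          congr 1
          ext j
          simp only [mem_map, mem_filter, mem_univ, true_and, Fin.valEmbedding_apply, mem_Ico]
          constructor
          · rintro ⟨j, hj, rfl⟩
            rw [← hj]
            exact ⟨Nat.div_mul_le_self _ _, Nat.lt_mul_of_div_lt (Nat.lt_succ_self _) hpos⟩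
          · intro hj
            refine ⟨⟨j, by omega⟩, ?_, rfl⟩
            exact Nat.div_eq_of_lt_le hj.1 hj.2
        _ = n - d := by rw [Nat.card_Ico, add_mul]; omega
    have := card_filter_add_card_filter_not (s := (univ : Finset (Fin n)))
      fun j : Fin n => (j : ℕ) / (n - d) = (i : ℕ) / (n - d)
    rw [hcompl, card_univ, Fintype.card_fin] at this
    simp only [ne_eq]
    omega
  · rw [Fin.card_filter_val_lt]
    omega

/-- After the failure of the nodes `n - 1, …, d`, in this order, all data come from the nodes
`0, …, d - 1`. -/
theorem minMinCut_fhs_le_mul {n k d : ℕ} (hkn : k ≤ n) (hdn : d < n) (α β : ENNReal) :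
    minMinCut k (fhs n d) α β ≤ d * α := by
  classical
  have hpos : 0 < n - d := by omega
  obtain ⟨S, -, hS⟩ := exists_subset_card_eq (s := (univ : Finset (Fin n))) (n := k)
    (by simpa using hkn)
  let F : Fin (n - d) → Fin n := fun τ => ⟨n - 1 - τ, by omega⟩
  have hF : ∀ j : Fin n, d ≤ (j : ℕ) → ∃ τ : Fin (n - d), F τ = j ∧ (τ : ℕ) = n - 1 - j :=
    fun j hj => ⟨⟨n - 1 - j, by omega⟩, Fin.ext (by simp only [F]; omega), rfl⟩
  -- Failures run downwards, so a helper numbered at least `d` has already been replaced. Indeed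
  -- nodes from `d` on meet only the last complete family and the incomplete one, and members of the
  -- latter have helpers below `d` only.
  have hsmall : ∀ τ j, j ∈ fhs n d (F τ) → d ≤ (j : ℕ) → (F τ : ℕ) < j := by
    intro τ j hj hdj
    have hτ : d ≤ (F τ : ℕ) := by simp only [F]; omega
    rw [fhs] at hj
    split_ifs at hj with h
    · simp only [mem_filter, mem_univ, true_and] at hj
      by_contra hcon
      have h1 : (j : ℕ) / (n - d) ≤ (F τ : ℕ) / (n - d) := Nat.div_le_div_right (by omega)
      have h2 : d / (n - d) ≤ (j : ℕ) / (n - d) := Nat.div_le_div_right hdj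
      have h3 : n / (n - d) = d / (n - d) + 1 := by
        rw [← Nat.add_div_right _ hpos]
        congr 1
        omega
      omega
    · simp only [mem_filter, mem_univ, true_and] at hj
      omega
  let L : Finset (Fin n) := univ.filter fun j : Fin n => (j : ℕ) < d
  refine (minMinCut_le (fhs n d) F α β ⟨S, hS⟩ (L.image Sum.inl) univ (fun _ _ => False)
    ?_ ?_).trans ?_
  · rintro (j | τ) hx -
    · refine Or.inl (mem_image_of_mem _ (mem_filter.2 ⟨mem_univ _, ?_⟩))
      by_contra hj
      obtain ⟨τ, hτ, -⟩ := hF j (not_lt.1 hj)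
      exact hx τ τ.2 hτ
    · exact Or.inr ⟨τ, mem_univ _, rfl⟩
  · rintro τ - (j | σ) hx hj hjL hσ
    · have hdj : d ≤ (j : ℕ) := by
        by_contra hcon
        exact hjL (mem_image_of_mem _ (mem_filter.2 ⟨mem_univ _, not_le.1 hcon⟩))
      have hlt := hsmall τ j hj hdj
      obtain ⟨σ, hσj, hσ⟩ := hF j hdj
      refine hx σ ?_ hσj
      simp only [F] at hlt
      omega
    · exact hσ σ (mem_univ _) rfl
  · simp only [if_false, sum_const_zero, add_zero]
    gcongr
    refine card_image_le.trans ?_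
    rw [Fin.card_filter_val_lt]
    exact min_le_right _ _

/-! ### Attainment of the minimal repair traffic. -/

theorem continuous_capacity {n k T : ℕ} (D : SHS n) (F : Fin T → Fin n) (α : ENNReal)
    (u v : Vertex n k T) : Continuous fun β => capacity k D F α β u v := by
  unfold capacity
  split
  · exact continuous_const
  · exact continuous_const
  · split_ifs
    · exact continuous_id
    · exact continuous_const
  · exact continuous_const
  · exact continuous_const

/-- Reliability is an intersection of conditions, one per cut, each bounding below a finite sum that
is continuous in `β`. -/
theorem isClosed_reliable {n k : ℕ} (D : SHS n) (M : ℝ) (α : ENNReal) :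
    IsClosed {β | Reliable k D M α β} := by
  simp only [Reliable, minMinCut, minCut, le_iInf_iff, Set.ofPred_forall]
  refine isClosed_iInter fun T => isClosed_iInter fun F => isClosed_iInter fun S =>
    isClosed_iInter fun U => isClosed_iInter fun _ => isClosed_iInter fun _ => ?_
  exact isClosed_le continuous_const
    (continuous_finsetSum _ fun u _ => continuous_finsetSum _ fun v _ =>
      continuous_capacity D F α u v)

end RegeneratingCodes

open RegeneratingCodes in
theorem mainTheorem8 (n k d : ℕ) (hn : 2 ≤ n) (hk : 1 ≤ k) (hkn : k ≤ n - 1)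
    (hd : 1 ≤ d) (hdn : d ≤ n - 1) (M : ℝ) (hM : 0 < M) :
    ∃ αMSR βMSR : ENNReal,
      RegeneratingCodes.IsMSRPoint k (RegeneratingCodes.fhs n d) M αMSR βMSR ∧
      αMSR = ENNReal.ofReal (M / (min d k : ℕ)) ∧
      (k ≤ d → βMSR = ENNReal.ofReal (M / ((k : ℝ) * ((d : ℝ) - (k : ℝ) + 1)))) ∧
      (d < k → βMSR ≤ ENNReal.ofReal (M / (d : ℝ))) := by
  have hdn' : d < n := by omega
  have hkn' : k ≤ n := by omega
  obtain ⟨m, hm⟩ : ∃ m, m = min d k := ⟨_, rfl⟩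
  have hm0 : m ≠ 0 := by omega
  have hmk : m ≤ k := by omega
  have hmd : m ≤ d := by omega
  have hmR : (0 : ℝ) < m := by positivity
  have hm0' : (m : ENNReal) ≠ 0 := by exact_mod_cast hm0
  have hc0 : ((d - m + 1 : ℕ) : ENNReal) ≠ 0 := by exact_mod_cast (Nat.succ_ne_zero (d - m))
  have hα : ENNReal.ofReal (M / m) = ENNReal.ofReal M / m := by
    rw [ENNReal.ofReal_div_of_pos hmR, ENNReal.ofReal_natCast]
  obtain ⟨α, hαdef⟩ : ∃ α, α = ENNReal.ofReal M / m := ⟨_, rfl⟩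
  have hαtop : α ≠ ⊤ := hαdef ▸ ENNReal.div_ne_top ENNReal.ofReal_ne_top hm0'
  have hmα : (m : ENNReal) * α = ENNReal.ofReal M := by
    rw [hαdef, ENNReal.mul_div_cancel hm0' (ENNReal.natCast_ne_top m)]
  have hrel : ∀ β, α ≤ ((d - m + 1 : ℕ) : ENNReal) * β → Reliable k (fhs n d) M α β := by
    intro β hβ
    refine le_trans ?_ (mul_min_le_minMinCut (fhs n d) (fun i => (card_fhs hdn' i).ge)
      hmk hmd α β)
    rw [min_eq_left hβ, hmα]
  have hcut : ∀ α' β, minMinCut k (fhs n d) α' β ≤ m * α' := by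
    intro α' β
    rcases le_total d k with h | h
    · rw [hm, min_eq_left h]
      exact minMinCut_fhs_le_mul hkn' hdn' α' β
    · rw [hm, min_eq_right h]
      exact minMinCut_le_mul hkn' _ α' β
  have hβ₀ : Reliable k (fhs n d) M α (α / (d - m + 1 : ℕ)) :=
    hrel _ (ENNReal.mul_div_cancel hc0 (ENNReal.natCast_ne_top _)).ge
  obtain ⟨β, hβ⟩ := (isClosed_reliable (k := k) (fhs n d) M α).isCompact.exists_isLeast ⟨_, hβ₀⟩
  refine ⟨α, β, ⟨⟨hrel ⊤ ?_, fun α' hα' => ?_⟩, hβ⟩, ?_, fun hkd => ?_, fun hdk => ?_⟩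
  · rw [ENNReal.mul_top hc0]
    exact le_top
  · rw [hαdef]
    exact ENNReal.div_le_of_le_mul' (le_trans hα' (hcut α' ⊤))
  · rw [← hm, hα, hαdef]
  · obtain rfl : m = k := by omega
    have hval : ENNReal.ofReal (M / ((m : ℝ) * ((d : ℝ) - (m : ℝ) + 1))) =
        α / (d - m + 1 : ℕ) := by
      have hcast : (d : ℝ) - (m : ℝ) + 1 = ((d - m + 1 : ℕ) : ℝ) := by
        push_cast [Nat.cast_sub hkd]
        rfl
      rw [hcast, ← div_div, ENNReal.ofReal_div_of_pos (by positivity), hα, hαdef,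
        ENNReal.ofReal_natCast]
    rw [hval]
    refine le_antisymm (hβ.2 hβ₀) (ENNReal.div_le_of_le_mul' ?_)
    -- Node `0` always lies in a complete family, so it is not its own helper.
    have hself : (⟨0, by omega⟩ : Fin n) ∉ fhs n d ⟨0, by omega⟩ := by
      have : n / (n - d) ≠ 0 := (Nat.div_pos (Nat.sub_le n d) (by omega)).ne'
      simp [fhs, Nat.pos_of_ne_zero this, hdn']
    have h1 := le_trans hβ.1 (minMinCut_le_of_helpers hk hkd (fhs n d) _ hself
      (card_fhs hdn' _) α β)
    rw [← hmα] at h1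
    have h2 : (m : ENNReal) * α = ((m - 1 : ℕ) : ENNReal) * α + α := by
      conv_lhs => rw [← Nat.sub_add_cancel hk]
      rw [Nat.cast_add, Nat.cast_one, add_mul, one_mul]
    rw [h2] at h1
    -- Cancelling `(k - 1) α`, which is finite, leaves `α ≤ (d - k + 1) β`.
    exact (ENNReal.add_le_add_iff_left
      (ENNReal.mul_ne_top (ENNReal.natCast_ne_top _) hαtop)).1 h1
  · obtain rfl : m = d := by omega
    rw [hα, ← hαdef]
    -- Here `m = d`, so the factor `d - m + 1` is `1` and `β = α` is enough.
    exact hβ.2 (hrel α (by simp))
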